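/- **Theorem 6.1.** Let the interest rate be zero. Let $X=(X_t)_{t\ge 0}$ be the stock price process, a martingale on a filtered probability space $(\Omega,\mathcal F,\{\mathcal F_t\},\mathbb P)$ with $X_0=x_0>0$ almost surely. Fix a maturity $T>0$, and suppose that the distribution of $X_T$ has a density $D_T$ on $(0,\infty)$ such that $$ D_T(x)=r_1x^{-r_3}\exp\{r_2\sqrt{\log x}\}(\log x)^{r_4}\left(1+O\left((\log x)^{-\frac12}\right)\right),\qquad x\to\infty, $$ where $r_1>0$, $r_2\ge 0$, $r_3>2$ and $r_4\in\mathbb R$. Let $C(K)=\mathbb E[(X_T-K)^+]$, and let $$ C_{BS}(T,K,\sigma)=x_0N(d_1)-KN(d_2),\qquad d_{1}=\frac{\log (x_0/K)}{\sigma\sqrt T}+\frac{\sigma\sqrt T}{2},\quad d_2=d_1-\sigma\sqrt T, $$ be the Black--Scholes call price, where $N$ is the standard normal distribution function. Then for all sufficiently large $K$ the equation $C_{BS}(T,K,\sigma)=C(K)$ has exactly one solution $\sigma>0$, the implied volatility $\sigma=I(K)$, and as $K\to\infty$, $$ \begin{aligned} I(K)={}&\frac{\sqrt2}{\sqrt T}\left(\sqrt{r_3-1}-\sqrt{r_3-2}\right)\sqrt{\log\frac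 K{x_0}} +\frac{r_2}{\sqrt{2T}}\left(\frac1{\sqrt{r_3-2}}-\frac1{\sqrt{r_3-1}}\right)\\ &+\frac{2r_4+1}{2\sqrt{2T}}\left(\frac1{\sqrt{r_3-2}}-\frac1{\sqrt{r_3-1}}\right)\frac{\log\log\frac K{x_0}}{\sqrt{\log\frac K{x_0}}}\\ &+\left[\frac1{\sqrt{2T}}\left(\frac1{\sqrt{r_3-1}}-\frac1{\sqrt{r_3-2}}\right)\log\frac{\sqrt{r_3-1}\sqrt{r_3-2}\left(\sqrt{r_3-1}-\sqrt{r_3-2}\right)}{2\sqrt\pi\,r_1x_0^{1-r_3}} +\frac{r_2^2}{4\sqrt{2T}}\left(\frac1{(r_3-2)^{3/2}}-\frac1{(r_3-1)^{3/2}}\right)\right]\frac1{\sqrt{\log\frac K{x_0}}}\\ &+\frac{r_2(2r_4+1)}{4\sqrt{2T}}\left(\frac1{(r_3-2)^{3/2}}-\frac1{(r_3-1)^{3/2}}\right)\frac{\log\log\frac K{x_0}}{\log\frac K{x_0}} +O\left(\frac1{\log\frac K{x_0}}\right). \end{aligned} $$ -/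

import Mathlib

open MeasureTheory ProbabilityTheory Filter Asymptotics
open scoped NNReal Topology

/-- Distribution function `N` of the standard normal law. -/
noncomputable def stdNormalCDF (d : ℝ) : ℝ := cdf (gaussianReal 0 1) d

/-- Black-Scholes call pricing function `C_BS(T, K, σ)` with zero interest rate and initial
stock price `x₀`: the value is `x₀ N(d₁) - K N(d₂)` with
`d₁ = log (x₀ / K) / (σ √T) + σ √T / 2` and `d₂ = d₁ - σ √T`.
It is used only for positive `x₀`, `T`, `K`, `σ`. -/
noncomputable def blackScholesCall (x₀ T K σ : ℝ) : ℝ :=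
  x₀ * stdNormalCDF (Real.log (x₀ / K) / (σ * √T) + σ * √T / 2)
    - K * stdNormalCDF (Real.log (x₀ / K) / (σ * √T) - σ * √T / 2)

/-- Call pricing function `C(K) = 𝔼[(S - K)⁺]`, where `S` is the stock price at maturity. -/
noncomputable def callPrice {Ω : Type*} [MeasurableSpace Ω] (P : Measure Ω) (S : Ω → ℝ)
    (K : ℝ) : ℝ :=
  ∫ ω, max (S ω - K) 0 ∂P

/-- `σ` is an implied volatility for maturity `T` and strike `K` when the call price is `c`. -/
def IsImpliedVolatility (x₀ T K c σ : ℝ) : Prop :=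
  0 < σ ∧ blackScholesCall x₀ T K σ = c

/-- `D` is a distribution density on `(0, ∞)` of the random variable `S`
(in particular `S > 0` almost surely). -/
def IsPositiveDensity {Ω : Type*} [MeasurableSpace Ω] (P : Measure Ω) (S : Ω → ℝ)
    (D : ℝ → ℝ) : Prop :=
  Measurable D ∧ (∀ x, 0 < x → 0 ≤ D x) ∧
    P.map S = (volume.restrict (Set.Ioi 0)).withDensity (fun x => ENNReal.ofReal (D x))

/-- `D(x) = r₁ x^{-r₃} exp(r₂ √(log x)) (log x)^{r₄} (1 + O((log x)^{-1/2}))` as `x → ∞`. -/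
def HasDensityTail (D : ℝ → ℝ) (r₁ r₂ r₃ r₄ : ℝ) : Prop :=
  ∃ ε : ℝ → ℝ, ε =O[atTop] (fun x => (Real.log x) ^ (-(1 / 2) : ℝ)) ∧
    ∀ᶠ x in atTop, D x =
      r₁ * x ^ (-r₃) * Real.exp (r₂ * √(Real.log x)) * (Real.log x) ^ r₄ * (1 + ε x)

/-!
The price depends on the volatility only through the total volatility `v = σ √T`, and on the strike
through the log-moneyness `L = log (K / x₀)`. Write `p = r₃ - 2`, `q = r₃ - 1`. Two asymptotic
formulas for the logarithm of the normalized price, both with error `O(1 / √L)`, are compared.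

* The call price is the tail integral of `(x - K) D(x)` over `(K, ∞)`
  (`callPrice_eq_setIntegral`). On this range the slowly varying factor of `D` may be replaced by
  its value at `L`, up to a factor `exp (± (c / √L) (1 + log (x / K)))`, that is, up to a perturbation
  of the exponent `r₃` by `c / √L` (`HasDensityTail.exists_log_bound`). Integrating pure powers
  gives `log (C(K) / x₀) = -p L + r₂ √L + r₄ log L + log (r₁ x₀ ^ (1 - r₃) / (p q)) + O(1 / √L)`
  (`log_callPrice_asymptotics`).
* On the Black-Scholes side let `w = d₁² / 2`. Since `d₂² - d₁² = 2 L`, the total volatility is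
  `v = √(2 (w + L)) - √(2 w)`, and since `e^L φ(d₂) = φ(d₁)`, the price is `φ(d₁)` times the
  difference of the Mills ratios at `√(2 w)` and `√(2 (w + L))`. The classical bounds for the Mills
  ratio give the logarithm of the price as `-w - (log L) / 2 + const + O(1 / √L)` whenever
  `w / L = p + O(1 / √L)` (`log_normalizedCall_totalVol`).

Equating the two suggests `w ≈ p L - B(L)` with `B(L) = r₂ √L + (r₄ + 1 / 2) log L - Λ`. Shifting this
guess by `± 1` changes the price by a factor close to `exp (∓ 1)`, so the given price lies in between
and the intermediate value theorem yields a solution; it is unique because the vega is positive.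
The solution has `w = p L - B(L) + s(L)` with `s` bounded, and comparing the two logarithms
once more improves this to `s = O(1 / √L)`. Expanding `√(2 (w + L)) - √(2 w)` to second order
(`sqrt_expansion`) turns the error into `O(1 / L)` and produces the five terms of the formula
(`totalVol_expansion`).
-/

/-! ### The standard normal distribution function and the Mills ratio -/

/-- Density of the standard normal law. -/
noncomputable def stdNormalPDF (x : ℝ) : ℝ := (√(2 * Real.pi))⁻¹ * Real.exp (-x ^ 2 / 2)

lemma stdNormalPDF_pos (x : ℝ) : 0 < stdNormalPDF x := by
  unfold stdNormalPDF; positivity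

lemma stdNormalPDF_neg (x : ℝ) : stdNormalPDF (-x) = stdNormalPDF x := by
  simp [stdNormalPDF]

lemma hasDerivAt_stdNormalPDF (x : ℝ) : HasDerivAt stdNormalPDF (-x * stdNormalPDF x) x := by
  have h : HasDerivAt (fun y : ℝ => -y ^ 2 / 2) (-x) x := by
    refine ((hasDerivAt_pow 2 x).neg.div_const 2).congr_deriv ?_
    push_cast
    ring
  refine (h.exp.const_mul (√(2 * Real.pi))⁻¹).congr_deriv ?_
  rw [stdNormalPDF]
  ring

lemma gaussianPDFReal_zero_one : gaussianPDFReal 0 1 = stdNormalPDF := by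
  ext x; simp [gaussianPDFReal_def, stdNormalPDF]

lemma stdNormalCDF_eq_integral (x : ℝ) :
    stdNormalCDF x = ∫ t in Set.Iic x, stdNormalPDF t := by
  rw [stdNormalCDF, cdf_eq_real, measureReal_def, gaussianReal_apply_eq_integral 0 one_ne_zero,
    gaussianPDFReal_zero_one, ENNReal.toReal_ofReal]
  exact integral_nonneg fun t => (stdNormalPDF_pos t).le

lemma integrable_stdNormalPDF : Integrable stdNormalPDF := by
  rw [← gaussianPDFReal_zero_one]; exact integrable_gaussianPDFReal 0 1

lemma hasDerivAt_stdNormalCDF (x : ℝ) : HasDerivAt stdNormalCDF (stdNormalPDF x) x := by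
  have hcont : Continuous stdNormalPDF :=
    continuous_iff_continuousAt.2 fun y => (hasDerivAt_stdNormalPDF y).continuousAt
  have h : stdNormalCDF = fun y => stdNormalCDF 0 + ∫ t in (0 : ℝ)..y, stdNormalPDF t := by
    ext y
    rw [← intervalIntegral.integral_Iic_sub_Iic integrable_stdNormalPDF.integrableOn
      integrable_stdNormalPDF.integrableOn, stdNormalCDF_eq_integral, stdNormalCDF_eq_integral]
    ring
  rw [h]
  exact (intervalIntegral.integral_hasDerivAt_right (hcont.intervalIntegrable _ _)
    (hcont.stronglyMeasurableAtFilter _ _) hcont.continuousAt).const_add _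

lemma tendsto_stdNormalCDF_neg_atTop : Tendsto (fun x => stdNormalCDF (-x)) atTop (𝓝 0) :=
  (tendsto_cdf_atBot (gaussianReal 0 1)).comp tendsto_neg_atTop_atBot

lemma tendsto_stdNormalPDF_atTop : Tendsto stdNormalPDF atTop (𝓝 0) := by
  have h : Tendsto (fun x : ℝ => -x ^ 2 / 2) atTop atBot := by
    have : Tendsto (fun x : ℝ => x ^ 2 / 2) atTop atTop :=
      (tendsto_pow_atTop two_ne_zero).atTop_div_const two_pos
    exact (tendsto_neg_atTop_atBot.comp this).congr fun x => (neg_div _ _).symm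
  have h2 := (Real.tendsto_exp_atBot.comp h).const_mul (√(2 * Real.pi))⁻¹
  rw [mul_zero] at h2
  exact h2

lemma hasDerivAt_stdNormalCDF_neg (x : ℝ) :
    HasDerivAt (fun y => stdNormalCDF (-y)) (-stdNormalPDF x) x := by
  have := (hasDerivAt_stdNormalCDF (-x)).comp x (hasDerivAt_neg x)
  rw [stdNormalPDF_neg] at this
  simpa using! this

lemma stdNormalCDF_neg_le {z : ℝ} (hz : 0 < z) :
    stdNormalCDF (-z) ≤ stdNormalPDF z * (1 / z) := by
  have hd : ∀ x ∈ Set.Ioi (0 : ℝ), HasDerivAt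
      (fun y => stdNormalCDF (-y) - stdNormalPDF y * y⁻¹) (stdNormalPDF x / x ^ 2) x := by
    intro x hx
    have hx' : x ≠ 0 := (Set.mem_Ioi.1 hx).ne'
    refine ((hasDerivAt_stdNormalCDF_neg x).sub
      ((hasDerivAt_stdNormalPDF x).mul (hasDerivAt_inv hx'))).congr_deriv ?_
    field_simp
    ring
  have hmono : MonotoneOn (fun y => stdNormalCDF (-y) - stdNormalPDF y * y⁻¹) (Set.Ioi 0) := by
    refine monotoneOn_of_deriv_nonneg (convex_Ioi 0)
      (fun x hx => (hd x hx).continuousAt.continuousWithinAt) ?_ ?_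
    · rw [interior_Ioi]
      exact fun x hx => (hd x hx).differentiableAt.differentiableWithinAt
    · rw [interior_Ioi]
      intro x hx
      rw [(hd x hx).deriv]
      have := stdNormalPDF_pos x
      positivity
  have hlim : Tendsto (fun y => stdNormalCDF (-y) - stdNormalPDF y * y⁻¹) atTop (𝓝 0) := by
    simpa using tendsto_stdNormalCDF_neg_atTop.sub
      (tendsto_stdNormalPDF_atTop.mul tendsto_inv_atTop_zero)
  have : stdNormalCDF (-z) - stdNormalPDF z * z⁻¹ ≤ 0 :=
    ge_of_tendsto hlim ((eventually_ge_atTop z).mono fun y hy => hmono hz (hz.trans_le hy) hy)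
  rw [one_div]; linarith

lemma le_stdNormalCDF_neg {z : ℝ} (hz : 0 < z) :
    stdNormalPDF z * (1 / z - 1 / z ^ 3) ≤ stdNormalCDF (-z) := by
  have hd : ∀ x ∈ Set.Ioi (0 : ℝ), HasDerivAt
      (fun y => stdNormalCDF (-y) - stdNormalPDF y * (y⁻¹ - (y ^ 3)⁻¹))
      (-(3 * stdNormalPDF x / x ^ 4)) x := by
    intro x hx
    have hx' : x ≠ 0 := (Set.mem_Ioi.1 hx).ne'
    refine ((hasDerivAt_stdNormalCDF_neg x).sub ((hasDerivAt_stdNormalPDF x).mul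
      ((hasDerivAt_inv hx').sub ((hasDerivAt_pow 3 x).inv (pow_ne_zero 3 hx'))))).congr_deriv ?_
    simp only [Pi.sub_apply, Pi.inv_apply]
    push_cast
    field_simp
    ring
  have hanti : AntitoneOn (fun y => stdNormalCDF (-y) - stdNormalPDF y * (y⁻¹ - (y ^ 3)⁻¹))
      (Set.Ioi 0) := by
    refine antitoneOn_of_deriv_nonpos (convex_Ioi 0)
      (fun x hx => (hd x hx).continuousAt.continuousWithinAt) ?_ ?_
    · rw [interior_Ioi]
      exact fun x hx => (hd x hx).differentiableAt.differentiableWithinAt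
    · rw [interior_Ioi]
      intro x hx
      rw [(hd x hx).deriv]
      have := stdNormalPDF_pos x
      exact neg_nonpos.2 (by positivity)
  have hlim : Tendsto (fun y => stdNormalCDF (-y) - stdNormalPDF y * (y⁻¹ - (y ^ 3)⁻¹))
      atTop (𝓝 0) := by
    have h3 : Tendsto (fun y : ℝ => (y ^ 3)⁻¹) atTop (𝓝 0) :=
      tendsto_inv_atTop_zero.comp (tendsto_pow_atTop (by norm_num))
    simpa using tendsto_stdNormalCDF_neg_atTop.sub
      (tendsto_stdNormalPDF_atTop.mul (tendsto_inv_atTop_zero.sub h3))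
  have : 0 ≤ stdNormalCDF (-z) - stdNormalPDF z * (z⁻¹ - (z ^ 3)⁻¹) :=
    le_of_tendsto hlim ((eventually_ge_atTop z).mono fun y hy => hanti hz (hz.trans_le hy) hy)
  rw [one_div, one_div]; linarith

/-- Mills ratio of the standard normal law: the upper tail divided by the density. -/
noncomputable def millsRatio (z : ℝ) : ℝ := stdNormalCDF (-z) / stdNormalPDF z

lemma abs_millsRatio_sub_le {z : ℝ} (hz : 0 < z) : |millsRatio z - 1 / z| ≤ 1 / z ^ 3 := by
  have hφ := stdNormalPDF_pos z
  have h1 : millsRatio z ≤ 1 / z := by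
    rw [millsRatio, div_le_iff₀ hφ, mul_comm]; exact stdNormalCDF_neg_le hz
  have h2 : 1 / z - 1 / z ^ 3 ≤ millsRatio z := by
    rw [millsRatio, le_div_iff₀ hφ, mul_comm]; exact le_stdNormalCDF_neg hz
  rw [abs_le]
  have : 0 < 1 / z ^ 3 := by positivity
  constructor <;> linarith

/-! ### The normalized Black-Scholes price -/

/-- Black-Scholes call price divided by the initial stock price, as a function of the
log-moneyness `L = log (K / x₀)` and the total volatility `v = σ √T`. -/
noncomputable def normalizedCall (L v : ℝ) : ℝ :=
  stdNormalCDF (-L / v + v / 2) - Real.exp L * stdNormalCDF (-L / v - v / 2)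

lemma blackScholesCall_eq {x₀ : ℝ} (hx₀ : 0 < x₀) (T L σ : ℝ) :
    blackScholesCall x₀ T (x₀ * Real.exp L) σ = x₀ * normalizedCall L (σ * √T) := by
  have h : Real.log (x₀ / (x₀ * Real.exp L)) = -L := by
    rw [div_mul_cancel_left₀ hx₀.ne', Real.log_inv, Real.log_exp]
  rw [blackScholesCall, h, normalizedCall]
  ring

/-- The call price increases with the volatility: its derivative (the vega) is the normal
density at `d₁`, since `e^L φ(d₂) = φ(d₁)`. -/
lemma hasDerivAt_normalizedCall (L : ℝ) {v : ℝ} (hv : v ≠ 0) :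
    HasDerivAt (normalizedCall L) (stdNormalPDF (-L / v + v / 2)) v := by
  have hφ : Real.exp L * stdNormalPDF (-L / v - v / 2) = stdNormalPDF (-L / v + v / 2) := by
    rw [stdNormalPDF, stdNormalPDF, mul_left_comm, ← Real.exp_add]
    congr 2
    field_simp
    ring
  have hL : HasDerivAt (fun y : ℝ => -L / y) (L / v ^ 2) v := by
    refine ((hasDerivAt_inv hv).const_mul (-L)).congr_deriv ?_
    field_simp
  have hh : HasDerivAt (fun y : ℝ => y / 2) (1 / 2) v := (hasDerivAt_id v).div_const 2
  have h1 := (hasDerivAt_stdNormalCDF (-L / v + v / 2)).comp v (hL.add hh)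
  have h2 := (hasDerivAt_stdNormalCDF (-L / v - v / 2)).comp v (hL.sub hh)
  refine (h1.sub (h2.const_mul (Real.exp L))).congr_deriv ?_
  rw [← mul_assoc, hφ]
  ring

lemma continuousOn_normalizedCall (L : ℝ) : ContinuousOn (normalizedCall L) (Set.Ioi 0) :=
  fun _ hv => (hasDerivAt_normalizedCall L (ne_of_gt hv)).continuousAt.continuousWithinAt

lemma strictMonoOn_normalizedCall (L : ℝ) : StrictMonoOn (normalizedCall L) (Set.Ioi 0) := by
  refine strictMonoOn_of_deriv_pos (convex_Ioi 0) (continuousOn_normalizedCall L) ?_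
  rw [interior_Ioi]
  intro v hv
  rw [(hasDerivAt_normalizedCall L (ne_of_gt hv)).deriv]
  exact stdNormalPDF_pos _

/-- Total volatility at which, for log-moneyness `L`, one has `-d₁ = √(2w)` and
`-d₂ = √(2(w + L))`. -/
noncomputable def totalVol (L w : ℝ) : ℝ := √(2 * (w + L)) - √(2 * w)

lemma totalVol_pos {L w : ℝ} (hL : 0 < L) (hw : 0 ≤ w) : 0 < totalVol L w :=
  sub_pos.2 (Real.sqrt_lt_sqrt (by linarith) (by linarith))

lemma div_totalVol {L w : ℝ} (hL : 0 < L) (hw : 0 ≤ w) :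
    L / totalVol L w = (√(2 * (w + L)) + √(2 * w)) / 2 := by
  have h1 := Real.sq_sqrt (show 0 ≤ 2 * (w + L) by linarith)
  have h2 := Real.sq_sqrt (show 0 ≤ 2 * w by linarith)
  rw [div_eq_iff (totalVol_pos hL hw).ne', totalVol]
  linear_combination (1 / 2 : ℝ) * (h2 - h1)

lemma stdNormalPDF_sqrt {w : ℝ} (hw : 0 ≤ w) :
    stdNormalPDF (√(2 * w)) = (√(2 * Real.pi))⁻¹ * Real.exp (-w) := by
  rw [stdNormalPDF, Real.sq_sqrt (by linarith)]
  congr 2; ring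

lemma normalizedCall_totalVol {L w : ℝ} (hL : 0 < L) (hw : 0 ≤ w) :
    normalizedCall L (totalVol L w) = (√(2 * Real.pi))⁻¹ * Real.exp (-w) *
      (millsRatio √(2 * w) - millsRatio √(2 * (w + L))) := by
  have h := div_totalVol hL hw
  have h1 : -L / totalVol L w + totalVol L w / 2 = -√(2 * w) := by
    rw [neg_div, h, totalVol]; ring
  have h2 : -L / totalVol L w - totalVol L w / 2 = -√(2 * (w + L)) := by
    rw [neg_div, h, totalVol]; ring
  rw [normalizedCall, h1, h2, millsRatio, millsRatio, stdNormalPDF_sqrt hw,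
    stdNormalPDF_sqrt (by linarith : 0 ≤ w + L), neg_add, Real.exp_add, Real.exp_neg L]
  have := Real.exp_pos L
  have := Real.exp_pos (-w)
  have : 0 < √(2 * Real.pi) := by positivity
  field_simp

/-! ### Asymptotics of the normalized call price -/

lemma tendsto_one_div_sqrt_atTop : Tendsto (fun L : ℝ => 1 / √L) atTop (𝓝 0) := by
  simpa only [one_div, Function.comp_def] using tendsto_inv_atTop_zero.comp Real.tendsto_sqrt_atTop

lemma isBigO_one_div_self_one_div_sqrt :
    (fun L : ℝ => 1 / L) =O[atTop] fun L => 1 / √L := by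
  refine IsBigO.of_bound 1 ?_
  filter_upwards [eventually_ge_atTop 1] with L hL
  have hs : 1 ≤ √L := Real.one_le_sqrt.2 hL
  rw [Real.norm_of_nonneg (by positivity), Real.norm_of_nonneg (by positivity), one_mul]
  exact one_div_le_one_div_of_le (by linarith) (by nlinarith [Real.sq_sqrt (by linarith : 0 ≤ L)])

/-- A function differentiable at `a` turns an approximation of `a` into an approximation of its
value at `a`, with an error of the same order. -/
lemma HasDerivAt.isBigO_comp_sub {α : Type*} {l : Filter α} {f : ℝ → ℝ} {f' a : ℝ}
    {u g : α → ℝ} (hf : HasDerivAt f f' a) (hg : Tendsto g l (𝓝 0))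
    (h : (fun x => u x - a) =O[l] g) : (fun x => f (u x) - f a) =O[l] g := by
  have hu : Tendsto u l (𝓝 a) := tendsto_sub_nhds_zero_iff.1 (h.trans_tendsto hg)
  exact (hf.isBigO_sub.comp_tendsto hu).trans h

lemma tendsto_of_isBigO_sub {u : ℝ → ℝ} {a : ℝ}
    (h : (fun L => u L - a) =O[atTop] fun L => 1 / √L) : Tendsto u atTop (𝓝 a) :=
  tendsto_sub_nhds_zero_iff.1 (h.trans_tendsto tendsto_one_div_sqrt_atTop)

lemma isBigO_one_of_tendsto_sub {u : ℝ → ℝ} {a : ℝ}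
    (h : (fun L => u L - a) =O[atTop] fun L => 1 / √L) :
    u =O[atTop] (fun _ => (1 : ℝ)) :=
  (tendsto_of_isBigO_sub h).isBigO_one ℝ

lemma isBigO_sqrt_mul_millsRatio_sub {p : ℝ} (hp : 0 < p) {w : ℝ → ℝ}
    (hw : (fun L => w L / L - p) =O[atTop] fun L => 1 / √L) :
    (fun L => √L * millsRatio √(2 * w L) - 1 / √(2 * p)) =O[atTop] fun L => 1 / √L := by
  have hd : DifferentiableAt ℝ (fun y : ℝ => 1 / √(2 * y)) p := by
    have h0 : 2 * p ≠ 0 := by positivity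
    have h1 : √(2 * p) ≠ 0 := by positivity
    fun_prop (disch := assumption)
  have hpos : ∀ᶠ L in atTop, 0 < w L := by
    filter_upwards [(tendsto_of_isBigO_sub hw).eventually (eventually_gt_nhds hp),
      eventually_gt_atTop 0] with L h1 h2
    exact (div_pos_iff_of_pos_right h2).1 h1
  have hmain : (fun L => √L * (1 / √(2 * w L)) - 1 / √(2 * p)) =O[atTop] fun L => 1 / √L := by
    refine (hd.hasDerivAt.isBigO_comp_sub tendsto_one_div_sqrt_atTop hw).congr' ?_ .rfl
    filter_upwards [hpos, eventually_gt_atTop 0] with L h1 h2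
    rw [← mul_div_assoc, Real.sqrt_div' _ h2.le]
    have : 0 < √(2 * w L) := by positivity
    have : 0 < √L := by positivity
    field_simp
  have herr : (fun L => √L * (millsRatio √(2 * w L) - 1 / √(2 * w L)))
      =O[atTop] fun L => 1 / √L := by
    have h3 : (fun L => (√L * (1 / √(2 * w L))) ^ 3 * (1 / L)) =O[atTop] fun L => 1 / √L := by
      simpa using ((isBigO_one_of_tendsto_sub hmain).pow 3).mul isBigO_one_div_self_one_div_sqrt
    refine IsBigO.trans (IsBigO.of_bound 1 ?_) h3
    filter_upwards [hpos, eventually_gt_atTop 0] with L h1 h2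
    have hz : 0 < √(2 * w L) := by positivity
    have hs : 0 < √L := by positivity
    rw [one_mul, norm_mul, Real.norm_of_nonneg hs.le, Real.norm_eq_abs,
      Real.norm_of_nonneg (by positivity)]
    refine (mul_le_mul_of_nonneg_left (abs_millsRatio_sub_le hz) hs.le).trans (le_of_eq ?_)
    have hsq : L = √L ^ 2 := (Real.sq_sqrt h2.le).symm
    generalize √L = r at *
    rw [hsq]
    field_simp
  refine (hmain.add herr).congr_left fun L => by ring

/-- Logarithmic asymptotics of the call price along total volatilities `totalVol L (w L)` with
`w L ≈ p L`: the density factor contributes `-w`, and the difference of the two Mills ratios is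
`κ / √L` with `κ = 1 / √(2p) - 1 / √(2(p + 1))`. -/
lemma log_normalizedCall_totalVol {p : ℝ} (hp : 0 < p) {w : ℝ → ℝ}
    (hw : (fun L => w L / L - p) =O[atTop] fun L => 1 / √L) :
    (∀ᶠ L in atTop, 0 < normalizedCall L (totalVol L (w L))) ∧
    (fun L => Real.log (normalizedCall L (totalVol L (w L))) -
      (-w L - 1 / 2 * Real.log L - Real.log √(2 * Real.pi)
        + Real.log (1 / √(2 * p) - 1 / √(2 * (p + 1))))) =O[atTop] fun L => 1 / √L := by
  have hκ : 0 < 1 / √(2 * p) - 1 / √(2 * (p + 1)) :=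
    sub_pos.2 (one_div_lt_one_div_of_lt (by positivity)
      (Real.sqrt_lt_sqrt (by positivity) (by linarith)))
  have hw' : (fun L => (w L + L) / L - (p + 1)) =O[atTop] fun L => 1 / √L := by
    refine hw.congr' ?_ .rfl
    filter_upwards [eventually_gt_atTop 0] with L hL
    field_simp
    ring
  have hpos : ∀ᶠ L in atTop, 0 < w L := by
    filter_upwards [(tendsto_of_isBigO_sub hw).eventually (eventually_gt_nhds hp),
      eventually_gt_atTop 0] with L h1 h2
    exact (div_pos_iff_of_pos_right h2).1 h1
  have hR : (fun L => √L * (millsRatio √(2 * w L) - millsRatio √(2 * (w L + L))) -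
      (1 / √(2 * p) - 1 / √(2 * (p + 1)))) =O[atTop] fun L => 1 / √L := by
    refine ((isBigO_sqrt_mul_millsRatio_sub hp hw).sub
      (isBigO_sqrt_mul_millsRatio_sub (by linarith : 0 < p + 1) hw')).congr_left fun L => by ring
  have hRpos : ∀ᶠ L in atTop,
      0 < √L * (millsRatio √(2 * w L) - millsRatio √(2 * (w L + L))) :=
    (tendsto_of_isBigO_sub hR).eventually (eventually_gt_nhds hκ)
  have hdiff : ∀ᶠ L in atTop, 0 < millsRatio √(2 * w L) - millsRatio √(2 * (w L + L)) := by
    filter_upwards [hRpos] with L h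
    exact pos_of_mul_pos_right h (Real.sqrt_nonneg L)
  constructor
  · filter_upwards [hpos, hdiff, eventually_gt_atTop 0] with L h1 h2 h3
    rw [normalizedCall_totalVol h3 h1.le]
    positivity
  · refine ((Real.hasDerivAt_log hκ.ne').isBigO_comp_sub tendsto_one_div_sqrt_atTop hR).congr'
      ?_ .rfl
    filter_upwards [hpos, hdiff, eventually_gt_atTop 0] with L h1 h2 h3
    have hs : √L ≠ 0 := by positivity
    have hπ : (√(2 * Real.pi))⁻¹ ≠ 0 := by positivity
    rw [normalizedCall_totalVol h3 h1.le, Real.log_mul hs h2.ne',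
      Real.log_mul (mul_ne_zero hπ (Real.exp_pos _).ne') h2.ne',
      Real.log_mul hπ (Real.exp_pos _).ne', Real.log_exp, Real.log_inv, Real.log_sqrt h3.le]
    ring

/-! ### The call price as a tail integral -/

lemma callPrice_eq_setIntegral {Ω : Type*} [MeasurableSpace Ω] {P : Measure Ω} {S : Ω → ℝ}
    (hS : AEMeasurable S P) {D : ℝ → ℝ} (hD : IsPositiveDensity P S D) {K : ℝ} (hK : 0 < K) :
    callPrice P S K = ∫ x in Set.Ioi K, (x - K) * D x := by
  obtain ⟨hm, hpos, hmap⟩ := hD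
  have hcont : Continuous fun x : ℝ => max (x - K) 0 := by fun_prop
  have h1 : callPrice P S K = ∫ x, max (x - K) 0 ∂(P.map S) :=
    (integral_map hS hcont.aestronglyMeasurable).symm
  rw [h1, hmap, integral_withDensity_eq_integral_toReal_smul hm.ennreal_ofReal
    (ae_of_all _ fun x => ENNReal.ofReal_lt_top)]
  rw [setIntegral_eq_of_subset_of_forall_sdiff_eq_zero (s := Set.Ioi K) measurableSet_Ioi
    (Set.Ioi_subset_Ioi hK.le)]
  · refine setIntegral_congr_fun measurableSet_Ioi fun x hx => ?_
    have hx' : K < x := hx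
    simp only [smul_eq_mul]
    rw [ENNReal.toReal_ofReal (hpos x (hK.trans hx')), max_eq_left (by linarith), mul_comm]
  · rintro x ⟨-, hx⟩
    have hx' : x ≤ K := not_lt.1 hx
    simp [max_eq_right (sub_nonpos.2 hx')]

lemma integrableOn_sub_mul_rpow {s K : ℝ} (hs : 2 < s) (hK : 0 < K) :
    IntegrableOn (fun x => (x - K) * x ^ (-s)) (Set.Ioi K) ∧
      ∫ x in Set.Ioi K, (x - K) * x ^ (-s) = K ^ (2 - s) / ((s - 1) * (s - 2)) := by
  have i1 := integrableOn_Ioi_rpow_of_lt (by linarith : 1 - s < -1) hK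
  have i2 := (integrableOn_Ioi_rpow_of_lt (by linarith : -s < -1) hK).const_mul K
  have heq : Set.EqOn (fun x : ℝ => x ^ (1 - s) - K * x ^ (-s)) (fun x => (x - K) * x ^ (-s))
      (Set.Ioi K) := by
    intro x hx
    have hx' : 0 < x := hK.trans hx
    simp only
    rw [show 1 - s = 1 + -s by ring, Real.rpow_add hx', Real.rpow_one]
    ring
  refine ⟨(i1.sub i2).congr_fun heq measurableSet_Ioi, ?_⟩
  rw [← setIntegral_congr_fun measurableSet_Ioi heq, integral_sub i1 i2, integral_const_mul,
    integral_Ioi_rpow_of_lt (by linarith) hK, integral_Ioi_rpow_of_lt (by linarith) hK,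
    show 1 - s + 1 = 2 - s by ring, show 2 - s = 1 + (-s + 1) by ring, Real.rpow_add hK 1,
    Real.rpow_one]
  have : s - 1 ≠ 0 := by linarith
  have : s - 2 ≠ 0 := by linarith
  have : -s + 1 ≠ 0 := by linarith
  have : 1 + (-s + 1) ≠ 0 := by linarith
  field_simp
  ring

lemma integrableOn_sub_mul_rpow_div_rpow {c r δ K : ℝ} (hr : 2 < r - δ) (hK : 0 < K) :
    IntegrableOn (fun x => (x - K) * (c * x ^ (-r) * (x / K) ^ δ)) (Set.Ioi K) ∧
      ∫ x in Set.Ioi K, (x - K) * (c * x ^ (-r) * (x / K) ^ δ) =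
        c * K ^ (2 - r) / ((r - δ - 1) * (r - δ - 2)) := by
  obtain ⟨h1, h2⟩ := integrableOn_sub_mul_rpow hr hK
  have heq : Set.EqOn (fun x : ℝ => c * K ^ (-δ) * ((x - K) * x ^ (-(r - δ))))
      (fun x => (x - K) * (c * x ^ (-r) * (x / K) ^ δ)) (Set.Ioi K) := by
    intro x hx
    have hx' : 0 < x := hK.trans hx
    simp only
    rw [show -(r - δ) = -r + δ by ring, Real.rpow_add hx', Real.div_rpow hx'.le hK.le,
      Real.rpow_neg hK.le δ]
    ring
  refine ⟨IntegrableOn.congr_fun (h1.const_mul _) heq measurableSet_Ioi, ?_⟩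
  rw [← setIntegral_congr_fun measurableSet_Ioi heq, integral_const_mul, h2, mul_div_assoc',
    mul_assoc c, ← Real.rpow_add hK, show -δ + (2 - (r - δ)) = 2 - r by ring]

/-- If on `(K, ∞)` the density is `c x^{-r}` up to a factor `exp (± δ (1 + log (x / K)))`, that
is, up to a constant factor and a small change of the exponent, then the tail integral is that
of `c x^{-r}` up to an explicit factor which tends to `1` as `δ → 0`. -/
lemma setIntegral_sub_mul_bounds {D : ℝ → ℝ} (hm : Measurable D) {c r δ K : ℝ} (hK : 0 < K)
    (hc : 0 < c) (hδ : 0 ≤ δ) (hr : 2 < r - δ) (hpos : ∀ x, K < x → 0 < D x)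
    (h : ∀ x, K < x → |Real.log (D x) - (Real.log c - r * Real.log x)|
      ≤ δ * (1 + Real.log (x / K))) :
    c * Real.exp (-δ) * K ^ (2 - r) / ((r + δ - 1) * (r + δ - 2))
        ≤ ∫ x in Set.Ioi K, (x - K) * D x ∧
      ∫ x in Set.Ioi K, (x - K) * D x
        ≤ c * Real.exp δ * K ^ (2 - r) / ((r - δ - 1) * (r - δ - 2)) := by
  have hexp : ∀ x, K < x → ∀ η : ℝ,
      c * Real.exp η * x ^ (-r) * (x / K) ^ η =
        Real.exp (Real.log c - r * Real.log x + η * (1 + Real.log (x / K))) := by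
    intro x hx η
    have hx' : 0 < x := hK.trans hx
    rw [Real.rpow_def_of_pos hx', Real.rpow_def_of_pos (div_pos hx' hK)]
    nth_rewrite 1 [← Real.exp_log hc]
    rw [← Real.exp_add, ← Real.exp_add, ← Real.exp_add]
    congr 1
    ring
  have hupper : ∀ x, K < x → D x ≤ c * Real.exp δ * x ^ (-r) * (x / K) ^ δ := by
    intro x hx
    rw [hexp x hx δ, ← Real.log_le_iff_le_exp (hpos x hx)]
    linarith [(abs_le.1 (h x hx)).2]
  have hlower : ∀ x, K < x → c * Real.exp (-δ) * x ^ (-r) * (x / K) ^ (-δ) ≤ D x := by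
    intro x hx
    rw [hexp x hx (-δ), ← Real.le_log_iff_exp_le (hpos x hx)]
    linarith [(abs_le.1 (h x hx)).1]
  obtain ⟨iu, eu⟩ := integrableOn_sub_mul_rpow_div_rpow (c := c * Real.exp δ) hr hK
  obtain ⟨il, el⟩ := integrableOn_sub_mul_rpow_div_rpow (c := c * Real.exp (-δ))
    (by linarith : 2 < r - -δ) hK
  have iD : IntegrableOn (fun x => (x - K) * D x) (Set.Ioi K) := by
    refine iu.mono' (by fun_prop) ?_
    filter_upwards [ae_restrict_mem measurableSet_Ioi] with x hx
    have hx' : 0 < x - K := sub_pos.2 hx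
    rw [Real.norm_of_nonneg (mul_nonneg hx'.le (hpos x hx).le)]
    exact mul_le_mul_of_nonneg_left (hupper x hx) hx'.le
  rw [sub_neg_eq_add] at el
  rw [← eu, ← el]
  exact ⟨setIntegral_mono_on il iD measurableSet_Ioi fun x hx =>
      mul_le_mul_of_nonneg_left (hlower x hx) (sub_pos.2 hx).le,
    setIntegral_mono_on iD iu measurableSet_Ioi fun x hx =>
      mul_le_mul_of_nonneg_left (hupper x hx) (sub_pos.2 hx).le⟩

/-! ### Slow variation of the density correction -/

lemma abs_sqrt_sub_sqrt_le {u L : ℝ} (hL : 0 < L) (hu : 0 ≤ u) :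
    |√u - √L| ≤ |u - L| / √L := by
  have hs : 0 < √L := Real.sqrt_pos.2 hL
  rw [le_div_iff₀ hs]
  have h : u - L = (√u - √L) * (√u + √L) := by
    linear_combination Real.sq_sqrt hL.le - Real.sq_sqrt hu
  rw [h, abs_mul]
  refine mul_le_mul_of_nonneg_left ?_ (abs_nonneg _)
  rw [abs_of_nonneg (by positivity)]
  linarith [Real.sqrt_nonneg u]

lemma abs_log_sub_log_le {u L : ℝ} (hL : 1 ≤ L) (hu : L / 4 ≤ u) :
    |Real.log u - Real.log L| ≤ 4 * |u - L| / √L := by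
  have hL0 : 0 < L := by linarith
  have hu0 : 0 < u := by linarith
  have hs : √L ≤ L := by
    rw [Real.sqrt_le_left hL0.le]; nlinarith
  have hs0 : 0 < √L := Real.sqrt_pos.2 hL0
  have hle : 4 * |u - L| / L ≤ 4 * |u - L| / √L :=
    div_le_div_of_nonneg_left (by positivity) hs0 hs
  refine le_trans ?_ hle
  rw [abs_le]
  have hlow := neg_abs_le (u - L)
  have hup := le_abs_self (u - L)
  constructor
  · have h1 := Real.log_le_sub_one_of_pos (div_pos hL0 hu0)
    rw [Real.log_div hL0.ne' hu0.ne'] at h1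
    have h2 : L / u - 1 ≤ 4 * |u - L| / L := by
      rw [div_sub_one hu0.ne', div_le_div_iff₀ hu0 hL0]
      calc (L - u) * L ≤ |u - L| * L := by gcongr; linarith
        _ ≤ |u - L| * (4 * u) := by gcongr; linarith
        _ = 4 * |u - L| * u := by ring
    linarith
  · have h1 := Real.log_le_sub_one_of_pos (div_pos hu0 hL0)
    rw [Real.log_div hu0.ne' hL0.ne', div_sub_one hL0.ne'] at h1
    refine h1.trans ?_
    gcongr
    linarith [abs_nonneg (u - L)]

/-- On `(K, ∞)` with `K = x₀ e^L`, the slowly varying factor of the density may be frozen at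
log-moneyness `L`, at the price of a relative error `exp (± (c / √L) (1 + log (x / K)))`. -/
lemma HasDensityTail.exists_log_bound {D : ℝ → ℝ} {r₁ r₂ r₃ r₄ : ℝ} (hr₁ : 0 < r₁)
    (hr₂ : 0 ≤ r₂) (h : HasDensityTail D r₁ r₂ r₃ r₄) {x₀ : ℝ} (hx₀ : 0 < x₀) :
    ∃ c : ℝ, 0 ≤ c ∧ ∀ᶠ L : ℝ in atTop, ∀ x, x₀ * Real.exp L < x → 0 < D x ∧
      |Real.log (D x) - (Real.log r₁ + r₂ * √L + r₄ * Real.log L - r₃ * Real.log x)|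
        ≤ c * (1 / √L) * (1 + Real.log (x / (x₀ * Real.exp L))) := by
  obtain ⟨ε, hε, hDε⟩ := h
  have hg : Tendsto (fun x : ℝ => Real.log x ^ (-(1 / 2) : ℝ)) atTop (𝓝 0) :=
    (tendsto_rpow_neg_atTop (by norm_num)).comp Real.tendsto_log_atTop
  have hε0 : Tendsto ε atTop (𝓝 0) := hε.trans_tendsto hg
  have hlog : (fun x => Real.log (1 + ε x)) =O[atTop]
      fun x => Real.log x ^ (-(1 / 2) : ℝ) := by
    have := (Real.hasDerivAt_log one_ne_zero).isBigO_comp_sub (u := fun x => 1 + ε x) hg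
      (by simpa using hε)
    simpa using this
  obtain ⟨C, hC, hCb⟩ := hlog.exists_pos
  have hev : ∀ᶠ x in atTop, D x =
        r₁ * x ^ (-r₃) * Real.exp (r₂ * √(Real.log x)) * (Real.log x) ^ r₄ * (1 + ε x) ∧
      0 < 1 + ε x ∧ |Real.log (1 + ε x)| ≤ C * (1 / √(Real.log x)) := by
    filter_upwards [hDε, hε0.eventually (eventually_gt_nhds (by norm_num : (-1 : ℝ) < 0)),
      hCb.bound, eventually_ge_atTop 1] with x h1 h2 h3 h4
    refine ⟨h1, by linarith, ?_⟩
    have hl : 0 ≤ Real.log x := Real.log_nonneg h4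
    rw [Real.rpow_neg hl, ← Real.sqrt_eq_rpow, ← one_div, Real.norm_of_nonneg (r := 1 / _)
      (by positivity), Real.norm_eq_abs] at h3
    exact h3
  obtain ⟨x₁, hx₁⟩ := eventually_atTop.1 hev
  have hKtop : Tendsto (fun L => x₀ * Real.exp L) atTop atTop :=
    Real.tendsto_exp_atTop.const_mul_atTop hx₀
  refine ⟨(r₂ + 4 * |r₄|) * (|Real.log x₀| + 1) + 2 * C, by positivity, ?_⟩
  filter_upwards [eventually_ge_atTop 1, eventually_ge_atTop (-2 * Real.log x₀),
    hKtop.eventually_ge_atTop x₁] with L hL1 hLx hLK x hx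
  obtain ⟨hD, hεp, hεl⟩ := hx₁ x (hLK.trans hx.le)
  have hK0 : 0 < x₀ * Real.exp L := by positivity
  have hx0 : 0 < x := hK0.trans hx
  have hL0 : 0 < L := by linarith
  have hy : 0 ≤ Real.log (x / (x₀ * Real.exp L)) :=
    Real.log_nonneg ((one_le_div hK0).2 hx.le)
  have hyeq : Real.log x = L + Real.log x₀ + Real.log (x / (x₀ * Real.exp L)) := by
    rw [Real.log_div hx0.ne' hK0.ne', Real.log_mul hx₀.ne' (Real.exp_pos L).ne', Real.log_exp]
    ring
  set y := Real.log (x / (x₀ * Real.exp L)) with hydef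
  set u := Real.log x with hudef
  have hu : L / 4 ≤ u := by linarith
  have hu0 : 0 < u := by linarith
  have hs : 0 < √L := Real.sqrt_pos.2 hL0
  refine ⟨by rw [hD]; positivity, ?_⟩
  have hlogD : Real.log (D x) = Real.log r₁ + -r₃ * u + r₂ * √u + r₄ * Real.log u
      + Real.log (1 + ε x) := by
    rw [hD, Real.log_mul (by positivity) hεp.ne', Real.log_mul (by positivity) (by positivity),
      Real.log_mul (by positivity) (by positivity), Real.log_mul hr₁.ne' (by positivity),
      Real.log_rpow hx0, Real.log_exp, Real.log_rpow hu0]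
  have huL : |u - L| ≤ (|Real.log x₀| + 1) * (1 + y) := by
    have : u - L = Real.log x₀ + y := by linarith
    rw [this]
    refine (abs_add_le _ _).trans ?_
    rw [abs_of_nonneg hy]
    nlinarith [abs_nonneg (Real.log x₀)]
  have hsu : 1 / √u ≤ 2 * (1 / √L) := by
    have h2 : √L / 2 ≤ √u := by
      refine Real.le_sqrt_of_sq_le ?_
      rw [div_pow, Real.sq_sqrt hL0.le]
      linarith
    calc 1 / √u ≤ 1 / (√L / 2) := one_div_le_one_div_of_le (by positivity) h2
      _ = 2 * (1 / √L) := by field_simp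
  have e1 : |r₂ * (√u - √L)| ≤ r₂ * (|u - L| / √L) := by
    rw [abs_mul, abs_of_nonneg hr₂]
    exact mul_le_mul_of_nonneg_left (abs_sqrt_sub_sqrt_le hL0 hu0.le) hr₂
  have e2 : |r₄ * (Real.log u - Real.log L)| ≤ |r₄| * (4 * |u - L| / √L) := by
    rw [abs_mul]
    exact mul_le_mul_of_nonneg_left (abs_log_sub_log_le hL1 hu) (abs_nonneg _)
  have hsplit : Real.log (D x) - (Real.log r₁ + r₂ * √L + r₄ * Real.log L - r₃ * u) =
      r₂ * (√u - √L) + r₄ * (Real.log u - Real.log L) + Real.log (1 + ε x) := by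
    rw [hlogD]; ring
  rw [hsplit]
  calc |r₂ * (√u - √L) + r₄ * (Real.log u - Real.log L) + Real.log (1 + ε x)|
      ≤ |r₂ * (√u - √L)| + |r₄ * (Real.log u - Real.log L)| + |Real.log (1 + ε x)| :=
        abs_add_three _ _ _
    _ ≤ r₂ * (|u - L| / √L) + |r₄| * (4 * |u - L| / √L) + C * (2 * (1 / √L)) := by
        gcongr
        exact hεl.trans (by gcongr)
    _ = ((r₂ + 4 * |r₄|) * |u - L| + 2 * C) * (1 / √L) := by ring
    _ ≤ ((r₂ + 4 * |r₄|) * ((|Real.log x₀| + 1) * (1 + y)) + 2 * C * (1 + y)) * (1 / √L) := by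
        refine mul_le_mul_of_nonneg_right (add_le_add
          (mul_le_mul_of_nonneg_left huL (by positivity)) ?_) (by positivity)
        nlinarith
    _ = _ := by ring

/-- Logarithmic asymptotics of the call price at strike `x₀ e^L`. -/
lemma log_callPrice_asymptotics {Ω : Type*} [MeasurableSpace Ω] {P : Measure Ω} {S : Ω → ℝ}
    (hS : AEMeasurable S P) {D : ℝ → ℝ} (hD : IsPositiveDensity P S D) {x₀ : ℝ} (hx₀ : 0 < x₀)
    {r₁ r₂ r₃ r₄ : ℝ} (hr₁ : 0 < r₁) (hr₂ : 0 ≤ r₂) (hr₃ : 2 < r₃)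
    (htail : HasDensityTail D r₁ r₂ r₃ r₄) :
    (∀ᶠ L in atTop, 0 < callPrice P S (x₀ * Real.exp L) / x₀) ∧
    (fun L => Real.log (callPrice P S (x₀ * Real.exp L) / x₀) -
      (-(r₃ - 2) * L + r₂ * √L + r₄ * Real.log L
        + Real.log (r₁ * x₀ ^ (1 - r₃) / ((r₃ - 1) * (r₃ - 2)))))
      =O[atTop] fun L => 1 / √L := by
  obtain ⟨c, hc, hbound⟩ := htail.exists_log_bound hr₁ hr₂ hx₀
  set δ : ℝ → ℝ := fun L => c * (1 / √L) with hδ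
  have hδO : δ =O[atTop] fun L => 1 / √L := (isBigO_refl _ _).const_mul_left c
  have hδ0 : Tendsto δ atTop (𝓝 0) := hδO.trans_tendsto tendsto_one_div_sqrt_atTop
  have hpq : 0 < (r₃ - 1) * (r₃ - 2) := mul_pos (by linarith) (by linarith)
  -- The error made in the logarithm when the exponent is changed by `η` in the sandwich bounds.
  have hψ : ∀ η : ℝ → ℝ, η =O[atTop] (fun L => 1 / √L) →
      (fun L => η L - (Real.log ((r₃ - η L - 1) * (r₃ - η L - 2))
        - Real.log ((r₃ - 1) * (r₃ - 2)))) =O[atTop] fun L => 1 / √L := by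
    intro η hη
    have hd : DifferentiableAt ℝ (fun t => Real.log ((r₃ - t - 1) * (r₃ - t - 2))) 0 := by
      refine DifferentiableAt.log (by fun_prop) ?_
      simpa using hpq.ne'
    have := hd.hasDerivAt.isBigO_comp_sub tendsto_one_div_sqrt_atTop (u := η) (by simpa using hη)
    exact hη.sub (by simpa using! this)
  have hsand : ∀ᶠ L in atTop, 0 < callPrice P S (x₀ * Real.exp L) / x₀ ∧
      ∀ M, M = -(r₃ - 2) * L + r₂ * √L + r₄ * Real.log L
        + Real.log (r₁ * x₀ ^ (1 - r₃) / ((r₃ - 1) * (r₃ - 2))) →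
      -δ L - (Real.log ((r₃ - -δ L - 1) * (r₃ - -δ L - 2)) - Real.log ((r₃ - 1) * (r₃ - 2)))
          ≤ Real.log (callPrice P S (x₀ * Real.exp L) / x₀) - M ∧
        Real.log (callPrice P S (x₀ * Real.exp L) / x₀) - M ≤
          δ L - (Real.log ((r₃ - δ L - 1) * (r₃ - δ L - 2))
            - Real.log ((r₃ - 1) * (r₃ - 2))) := by
    filter_upwards [hbound, hδ0.eventually (eventually_lt_nhds (by linarith : 0 < r₃ - 2)),
      eventually_gt_atTop 0] with L h1 h2 hL
    have hK : 0 < x₀ * Real.exp L := by positivity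
    have hδL : 0 ≤ δ L := by positivity
    have hE : 0 < r₁ * Real.exp (r₂ * √L + r₄ * Real.log L) := by positivity
    have hlogE : Real.log (r₁ * Real.exp (r₂ * √L + r₄ * Real.log L))
        = Real.log r₁ + r₂ * √L + r₄ * Real.log L := by
      rw [Real.log_mul hr₁.ne' (Real.exp_pos _).ne', Real.log_exp]; ring
    obtain ⟨hlo, hup⟩ := setIntegral_sub_mul_bounds hD.1 hK hE hδL
      (by linarith : 2 < r₃ - δ L) (fun x hx => (h1 x hx).1)
      (fun x hx => by rw [hlogE]; exact (h1 x hx).2)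
    rw [← callPrice_eq_setIntegral hS hD hK] at hlo hup
    rw [← sub_neg_eq_add r₃ (δ L)] at hlo
    -- The logarithm of each sandwich bound, divided by `x₀`.
    have hval : ∀ η : ℝ, 0 < r₃ - η - 2 →
        Real.log (r₁ * Real.exp (r₂ * √L + r₄ * Real.log L) * Real.exp η
            * (x₀ * Real.exp L) ^ (2 - r₃) / ((r₃ - η - 1) * (r₃ - η - 2)) / x₀) =
          (-(r₃ - 2) * L + r₂ * √L + r₄ * Real.log L
            + Real.log (r₁ * x₀ ^ (1 - r₃) / ((r₃ - 1) * (r₃ - 2)))) +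
          (η - (Real.log ((r₃ - η - 1) * (r₃ - η - 2)) - Real.log ((r₃ - 1) * (r₃ - 2)))) := by
      intro η hη
      have hη1 : 0 < r₃ - η - 1 := by linarith
      have hη2 : 0 < (r₃ - η - 1) * (r₃ - η - 2) := mul_pos hη1 hη
      rw [Real.log_div (by positivity) hx₀.ne', Real.log_div (by positivity) hη2.ne',
        Real.log_mul (by positivity) (by positivity), Real.log_mul hE.ne' (by positivity), hlogE,
        Real.log_exp, Real.log_rpow hK, Real.log_mul hx₀.ne' (Real.exp_pos _).ne', Real.log_exp,
        Real.log_div (by positivity) hpq.ne', Real.log_mul hr₁.ne' (by positivity),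
        Real.log_rpow hx₀]
      ring
    have hη1 : 0 < r₃ - δ L - 2 := by linarith
    have hη2 : 0 < r₃ - -δ L - 2 := by linarith
    have hlopos : 0 < r₁ * Real.exp (r₂ * √L + r₄ * Real.log L) * Real.exp (-δ L)
            * (x₀ * Real.exp L) ^ (2 - r₃) / ((r₃ - -δ L - 1) * (r₃ - -δ L - 2)) / x₀ := by
      have : 0 < r₃ - -δ L - 1 := by linarith
      positivity
    have hlo' : _ ≤ callPrice P S (x₀ * Real.exp L) / x₀ :=
      div_le_div_of_nonneg_right hlo hx₀.le
    have hup' : callPrice P S (x₀ * Real.exp L) / x₀ ≤ _ :=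
      div_le_div_of_nonneg_right hup hx₀.le
    have hCpos := hlopos.trans_le hlo'
    refine ⟨hCpos, ?_⟩
    rintro M rfl
    have a1 := Real.log_le_log hlopos hlo'
    have a2 := Real.log_le_log hCpos hup'
    rw [hval _ hη2] at a1
    rw [hval _ hη1] at a2
    constructor <;> linarith
  refine ⟨hsand.mono fun L h => h.1, ?_⟩
  have hlo := hψ _ hδO.neg_left
  have hup := hψ _ hδO
  refine IsBigO.trans (IsBigO.of_bound 1 ?_) (hlo.norm_left.add hup.norm_left)
  filter_upwards [hsand] with L h
  obtain ⟨b1, b2⟩ := h.2 _ rfl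
  rw [one_mul, Real.norm_eq_abs, Real.norm_of_nonneg (by positivity), Real.norm_eq_abs,
    Real.norm_eq_abs]
  refine abs_le.2 ⟨?_, ?_⟩
  · refine le_trans ?_ b1
    linarith [neg_abs_le (-δ L - (Real.log ((r₃ - -δ L - 1) * (r₃ - -δ L - 2))
      - Real.log ((r₃ - 1) * (r₃ - 2)))), abs_nonneg (δ L - (Real.log ((r₃ - δ L - 1)
      * (r₃ - δ L - 2)) - Real.log ((r₃ - 1) * (r₃ - 2))))]
  · refine b2.trans ?_
    linarith [le_abs_self (δ L - (Real.log ((r₃ - δ L - 1) * (r₃ - δ L - 2))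
      - Real.log ((r₃ - 1) * (r₃ - 2)))), abs_nonneg (-δ L - (Real.log ((r₃ - -δ L - 1)
      * (r₃ - -δ L - 2)) - Real.log ((r₃ - 1) * (r₃ - 2))))]

/-! ### Second-order expansion of a square root -/

lemma abs_sqrt_one_add_sub_le {y : ℝ} (hy : |y| ≤ 1) :
    |√(1 + y) - (1 + y / 2 - y ^ 2 / 8)| ≤ |y| ^ 3 := by
  have h1 : 0 ≤ 1 + y := by linarith [(abs_le.1 hy).1]
  have hr := Real.sqrt_nonneg (1 + y)
  have hsq := Real.sq_sqrt h1
  generalize √(1 + y) = r at *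
  obtain rfl : y = r ^ 2 - 1 := by linarith
  have ht : |r - 1| ≤ |r ^ 2 - 1| := by
    rw [show r ^ 2 - 1 = (r - 1) * (r + 1) by ring, abs_mul, abs_of_nonneg (by linarith : 0 ≤ r + 1)]
    nlinarith [abs_nonneg (r - 1)]
  have hid : r - (1 + (r ^ 2 - 1) / 2 - (r ^ 2 - 1) ^ 2 / 8) = (r - 1) ^ 3 * ((r + 3) / 8) := by
    ring
  have hr2 : r ≤ 2 := by nlinarith [(abs_le.1 hy).2]
  rw [hid, abs_mul, abs_pow, abs_of_nonneg (by linarith : 0 ≤ (r + 3) / 8)]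
  calc |r - 1| ^ 3 * ((r + 3) / 8) ≤ |r ^ 2 - 1| ^ 3 * 1 := by
        gcongr
        linarith
    _ = _ := mul_one _

lemma isBigO_log_sq_sqrt {m k : ℝ} {s : ℝ → ℝ} (hs : s =O[atTop] fun _ => (1 : ℝ)) :
    (fun L => (m * Real.log L - k - s L) ^ 2) =O[atTop] fun L => √L := by
  have hrp : (fun _ : ℝ => (1 : ℝ)) =O[atTop] fun L => L ^ (1 / 4 : ℝ) :=
    ((isLittleO_const_left.2 (Or.inr (tendsto_norm_atTop_atTop.comp
      (tendsto_rpow_atTop (by norm_num))))).isBigO)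
  have hlog : (fun L => Real.log L) =O[atTop] fun L => L ^ (1 / 4 : ℝ) :=
    (isLittleO_log_rpow_atTop (by norm_num)).isBigO
  have hk : (fun _ : ℝ => k) =O[atTop] fun _ => (1 : ℝ) := isBigO_const_const _ one_ne_zero _
  refine ((((hlog.const_mul_left m).sub (hk.trans hrp)).sub (hs.trans hrp)).pow 2).congr' .rfl ?_
  filter_upwards [eventually_ge_atTop 0] with L hL
  rw [← Real.rpow_natCast, ← Real.rpow_mul hL, Real.sqrt_eq_rpow]
  norm_num

lemma isBigO_log_sqrt {m k : ℝ} {s : ℝ → ℝ} (hs : s =O[atTop] fun _ => (1 : ℝ)) :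
    (fun L => m * Real.log L - k - s L) =O[atTop] fun L => √L := by
  have h1 : (fun _ : ℝ => (1 : ℝ)) =O[atTop] fun L => √L :=
    (isLittleO_const_left.2 (Or.inr (tendsto_norm_atTop_atTop.comp
      Real.tendsto_sqrt_atTop))).isBigO
  have hlog : (fun L => Real.log L) =O[atTop] fun L => √L := by
    simpa only [Real.sqrt_eq_rpow] using
      (isLittleO_log_rpow_atTop (by norm_num : (0 : ℝ) < 1 / 2)).isBigO
  have hk : (fun _ : ℝ => k) =O[atTop] fun _ => (1 : ℝ) := isBigO_const_const _ one_ne_zero _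
  exact ((hlog.const_mul_left m).sub (hk.trans h1)).sub (hs.trans h1)

/-- Expansion of `√(2(aL - B(L) + s(L)))` up to `O(1 / L)`, where
`B(L) = b √L + m log L - k` and `s = O(1 / √L)`. -/
lemma sqrt_expansion {a b m k : ℝ} (ha : 0 < a) {s : ℝ → ℝ}
    (hs : s =O[atTop] fun L => 1 / √L) :
    (fun L => √(2 * (a * L - (b * √L + m * Real.log L - k) + s L)) -
      (√2 * √a * √L - √2 / (2 * √a) * (b + m * (Real.log L / √L) - k * (1 / √L))
        - √2 / (8 * (a * √a)) * (b ^ 2 * (1 / √L) + 2 * b * m * (Real.log L / L))))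
      =O[atTop] fun L => 1 / L := by
  have hs1 : s =O[atTop] fun _ => (1 : ℝ) :=
    hs.trans (tendsto_one_div_sqrt_atTop.isBigO_one ℝ)
  set β : ℝ → ℝ := fun L => b * √L + (m * Real.log L - k - s L) with hβ
  have hβO : β =O[atTop] fun L => √L :=
    ((isBigO_refl _ _).const_mul_left b).add (isBigO_log_sqrt hs1)
  set y : ℝ → ℝ := fun L => -(1 / a) * (β L * (1 / L)) with hy
  have hyO : y =O[atTop] fun L => 1 / √L := by
    refine ((hβO.mul (isBigO_refl (fun L : ℝ => 1 / L) atTop)).const_mul_left _).congr' .rfl ?_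
    filter_upwards [eventually_gt_atTop 0] with L hL
    have := Real.sq_sqrt hL.le
    have : 0 < √L := Real.sqrt_pos.2 hL
    field_simp
    linarith
  have hy0 : Tendsto y atTop (𝓝 0) := hyO.trans_tendsto tendsto_one_div_sqrt_atTop
  have t1 : (fun L => √2 * √a * (√L * (√(1 + y L) - (1 + y L / 2 - y L ^ 2 / 8))))
      =O[atTop] fun L => 1 / L := by
    have hrem : (fun L => √(1 + y L) - (1 + y L / 2 - y L ^ 2 / 8))
        =O[atTop] fun L => (1 / √L) ^ 3 := by
      refine IsBigO.trans (IsBigO.of_bound 1 ?_) (hyO.pow 3)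
      filter_upwards [hy0.abs.eventually (eventually_le_nhds (by simp : |(0 : ℝ)| < 1))] with L h
      rw [one_mul, norm_pow]
      exact abs_sqrt_one_add_sub_le h
    refine (((isBigO_refl (fun L : ℝ => √L) atTop).mul hrem).const_mul_left _).congr' .rfl ?_
    filter_upwards [eventually_gt_atTop 0] with L hL
    have := Real.sq_sqrt hL.le
    have : 0 < √L := Real.sqrt_pos.2 hL
    field_simp
    linarith
  have t2 : (fun L => √2 / (2 * √a) * (s L * (1 / √L))) =O[atTop] fun L => 1 / L := by
    refine ((hs.mul (isBigO_refl (fun L : ℝ => 1 / √L) atTop)).const_mul_left _).congr' .rfl ?_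
    filter_upwards [eventually_gt_atTop 0] with L hL
    rw [div_mul_div_comm, one_mul, Real.mul_self_sqrt hL.le]
  have t3 : (fun L => √2 / (8 * (a * √a)) * (2 * b * ((-k - s L) * (1 / L))))
      =O[atTop] fun L => 1 / L := by
    have hk : (fun L => -k - s L) =O[atTop] fun _ => (1 : ℝ) :=
      (isBigO_const_const _ one_ne_zero _).sub hs1
    simpa using ((hk.mul (isBigO_refl (fun L : ℝ => 1 / L) atTop)).const_mul_left
      (2 * b)).const_mul_left (√2 / (8 * (a * √a)))
  have t4 : (fun L => √2 / (8 * (a * √a)) * ((m * Real.log L - k - s L) ^ 2 * (1 / (L * √L))))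
      =O[atTop] fun L => 1 / L := by
    refine (((isBigO_log_sq_sqrt hs1).mul
      (isBigO_refl (fun L : ℝ => 1 / (L * √L)) atTop)).const_mul_left _).congr' .rfl ?_
    filter_upwards [eventually_gt_atTop 0] with L hL
    have : 0 < √L := Real.sqrt_pos.2 hL
    field_simp
  refine (((t1.add t2).sub t3).sub t4).congr' ?_ .rfl
  filter_upwards [eventually_gt_atTop 0, hy0.eventually (eventually_gt_nhds
    (by norm_num : (-1 : ℝ) < 0))] with L hL hyL
  have hroot : √(2 * (a * L - (b * √L + m * Real.log L - k) + s L))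
      = √2 * √a * √L * √(1 + y L) := by
    rw [← Real.sqrt_mul (by norm_num), ← Real.sqrt_mul (by positivity),
      ← Real.sqrt_mul (by positivity)]
    congr 1
    simp only [hy, hβ]
    field_simp
    ring
  rw [hroot]
  simp only [hy, hβ]
  have hL2 : L = √L ^ 2 := (Real.sq_sqrt hL.le).symm
  have ha2 : a = √a ^ 2 := (Real.sq_sqrt ha.le).symm
  have hr : 0 < √L := Real.sqrt_pos.2 hL
  have hα : 0 < √a := Real.sqrt_pos.2 ha
  generalize √(1 + -(1 / a) * ((b * √L + (m * Real.log L - k - s L)) * (1 / L))) = R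
  generalize Real.log L = ℓ
  generalize s L = σ
  generalize √L = r at *
  generalize √a = α at *
  subst hL2 ha2
  field_simp
  ring

/-! ### Solving for the total volatility -/

section TotalVolatility

variable {p b d c₀ : ℝ} {c : ℝ → ℝ}

/-- The constant `Λ` for which `p L - b √L - (d + 1 / 2) log L + Λ` approximates `d₁² / 2` at the
implied volatility, when the normalized price is asymptotic to
`c₀ / (p (p + 1)) * exp (-p L + b √L) * L ^ d`. -/
noncomputable def volConst (p c₀ : ℝ) : ℝ :=
  Real.log (√(p + 1) * √p * (√(p + 1) - √p) / (2 * √Real.pi * c₀))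

/-- `Λ` collects the constants of the two logarithmic asymptotics. -/
lemma volConst_eq (hp : 0 < p) (hc₀ : 0 < c₀) :
    volConst p c₀ = Real.log (1 / √(2 * p) - 1 / √(2 * (p + 1))) - Real.log √(2 * Real.pi)
      - Real.log (c₀ / ((p + 1) * p)) := by
  have hlt : √p < √(p + 1) := Real.sqrt_lt_sqrt hp.le (by linarith)
  have hκ : 0 < 1 / √(2 * p) - 1 / √(2 * (p + 1)) :=
    sub_pos.2 (one_div_lt_one_div_of_lt (by positivity)
      (Real.sqrt_lt_sqrt (by positivity) (by linarith)))
  have hq : 0 < p + 1 := by linarith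
  have hpi : 0 < √(2 * Real.pi) := by positivity
  rw [← Real.log_div hκ.ne' hpi.ne', ← Real.log_div (by positivity) (by positivity), volConst]
  congr 1
  rw [Real.sqrt_mul zero_le_two, Real.sqrt_mul zero_le_two, Real.sqrt_mul zero_le_two]
  have h2 : √2 ^ 2 = (2 : ℝ) := Real.sq_sqrt zero_le_two
  have hpp : √p ^ 2 = p := Real.sq_sqrt hp.le
  have hqq : √(p + 1) ^ 2 = p + 1 := Real.sq_sqrt hq.le
  have : 0 < √p := Real.sqrt_pos.2 hp
  have : 0 < √(p + 1) := Real.sqrt_pos.2 hq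
  have : 0 < √Real.pi := Real.sqrt_pos.2 Real.pi_pos
  rw [← hpp] at hqq ⊢
  rw [Real.sqrt_sq (by positivity), ← hqq]
  rw [Real.sqrt_sq (by positivity)]
  field_simp
  rw [h2]

/-- Approximate value of `d₁² / 2` at the implied volatility, for log-moneyness `L` and a normalized
price asymptotic to `c₀ / (p (p + 1)) * exp (-p L + b √L) * L ^ d`. -/
noncomputable def halfSqApprox (p b d c₀ L : ℝ) : ℝ :=
  p * L - (b * √L + (d + 1 / 2) * Real.log L - volConst p c₀)

lemma halfSqApprox_add_isBigO {s : ℝ → ℝ} (hs : s =O[atTop] fun _ => (1 : ℝ)) :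
    (fun L => (halfSqApprox p b d c₀ L + s L) / L - p) =O[atTop] fun L => 1 / √L := by
  have h : (fun L => -(b * √L + ((d + 1 / 2) * Real.log L - volConst p c₀ - s L)))
      =O[atTop] fun L => √L :=
    (((isBigO_refl _ _).const_mul_left b).add (isBigO_log_sqrt hs)).neg_left
  refine (h.mul (isBigO_refl (fun L : ℝ => 1 / L) atTop)).congr' ?_ ?_
  · filter_upwards [eventually_gt_atTop 0] with L hL
    rw [halfSqApprox]
    field_simp
    ring
  · filter_upwards [eventually_gt_atTop 0] with L hL
    have := Real.sq_sqrt hL.le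
    have : 0 < √L := Real.sqrt_pos.2 hL
    field_simp
    linarith

/-- A bounded shift `s` of the approximate value of `d₁² / 2` multiplies the ratio of the
Black-Scholes price to the given price `c` by `exp (-s)`, up to `exp (O(1 / √L))`. -/
lemma log_normalizedCall_sub_log (hp : 0 < p) (hc₀ : 0 < c₀)
    (hc : (fun L => Real.log (c L) - (-p * L + b * √L + d * Real.log L
      + Real.log (c₀ / ((p + 1) * p)))) =O[atTop] fun L => 1 / √L)
    {s : ℝ → ℝ} (hs : s =O[atTop] fun _ => (1 : ℝ)) :
    (∀ᶠ L in atTop, 0 < normalizedCall L (totalVol L (halfSqApprox p b d c₀ L + s L))) ∧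
    (fun L => Real.log (normalizedCall L (totalVol L (halfSqApprox p b d c₀ L + s L)))
      - Real.log (c L) + s L) =O[atTop] fun L => 1 / √L := by
  obtain ⟨h1, h2⟩ := log_normalizedCall_totalVol hp
    (halfSqApprox_add_isBigO (b := b) (d := d) (c₀ := c₀) hs)
  refine ⟨h1, (h2.sub hc).congr_left fun L => ?_⟩
  have := volConst_eq hp hc₀
  rw [halfSqApprox]
  linear_combination this

/-- For large log-moneyness the price `c L` is attained at a total volatility whose parameter is
within distance `1` of the approximate one. -/
lemma eventually_exists_totalVol (hp : 0 < p) (hc₀ : 0 < c₀) (hcpos : ∀ᶠ L in atTop, 0 < c L)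
    (hc : (fun L => Real.log (c L) - (-p * L + b * √L + d * Real.log L
      + Real.log (c₀ / ((p + 1) * p)))) =O[atTop] fun L => 1 / √L) :
    ∀ᶠ L in atTop, ∃ w, |w - halfSqApprox p b d c₀ L| ≤ 1 ∧ 0 < totalVol L w ∧
      normalizedCall L (totalVol L w) = c L := by
  have h1 : (fun _ : ℝ => (1 : ℝ)) =O[atTop] fun _ => (1 : ℝ) := isBigO_refl _ _
  obtain ⟨pp, hpO⟩ := log_normalizedCall_sub_log hp hc₀ hc h1
  obtain ⟨mp, hmO⟩ := log_normalizedCall_sub_log hp hc₀ hc h1.neg_left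
  have hw := tendsto_of_isBigO_sub
    (halfSqApprox_add_isBigO (p := p) (b := b) (d := d) (c₀ := c₀) h1.neg_left)
  filter_upwards [pp, mp, hcpos, eventually_gt_atTop 0, hw.eventually (eventually_gt_nhds hp),
    (hpO.trans_tendsto tendsto_one_div_sqrt_atTop).eventually (eventually_lt_nhds one_pos),
    (hmO.trans_tendsto tendsto_one_div_sqrt_atTop).eventually
      (eventually_gt_nhds (by norm_num : (-1 : ℝ) < 0))] with L a1 a2 a3 hL a4 a5 a6
  have hwpos : 0 < halfSqApprox p b d c₀ L + -1 := (div_pos_iff_of_pos_right hL).1 a4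
  have hlo : normalizedCall L (totalVol L (halfSqApprox p b d c₀ L + 1)) ≤ c L :=
    (Real.log_le_log_iff a1 a3).1 (by linarith)
  have hup : c L ≤ normalizedCall L (totalVol L (halfSqApprox p b d c₀ L + -1)) :=
    (Real.log_le_log_iff a3 a2).1 (by linarith)
  have hcont : ContinuousOn (fun w => normalizedCall L (totalVol L w))
      (Set.Icc (halfSqApprox p b d c₀ L + -1) (halfSqApprox p b d c₀ L + 1)) := by
    refine (continuousOn_normalizedCall L).comp ?_ fun w hw => ?_
    · unfold totalVol
      fun_prop
    · exact totalVol_pos hL (hwpos.le.trans hw.1)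
  obtain ⟨w, ⟨w1, w2⟩, hwc⟩ := intermediate_value_Icc' (by linarith) hcont ⟨hlo, hup⟩
  exact ⟨w, abs_le.2 ⟨by linarith, by linarith⟩, totalVol_pos hL (hwpos.le.trans w1), hwc⟩

lemma eventually_existsUnique_totalVol (hp : 0 < p) (hc₀ : 0 < c₀)
    (hcpos : ∀ᶠ L in atTop, 0 < c L)
    (hc : (fun L => Real.log (c L) - (-p * L + b * √L + d * Real.log L
      + Real.log (c₀ / ((p + 1) * p)))) =O[atTop] fun L => 1 / √L) :
    ∀ᶠ L in atTop, ∃! v, 0 < v ∧ normalizedCall L v = c L := by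
  filter_upwards [eventually_exists_totalVol hp hc₀ hcpos hc] with L h
  obtain ⟨w, -, h1, h2⟩ := h
  exact ⟨totalVol L w, ⟨h1, h2⟩, fun v hv =>
    (strictMonoOn_normalizedCall L).injOn hv.1 h1 (hv.2.trans h2.symm)⟩

/-- Expansion of the total volatility. The bounded deviation of `d₁² / 2` from its approximate
value is first improved to `O(1 / √L)` by comparing prices, and then the difference of the two
square roots `-d₂` and `-d₁` is expanded. -/
lemma totalVol_expansion (hp : 0 < p) (hc₀ : 0 < c₀) (hcpos : ∀ᶠ L in atTop, 0 < c L)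
    (hc : (fun L => Real.log (c L) - (-p * L + b * √L + d * Real.log L
      + Real.log (c₀ / ((p + 1) * p)))) =O[atTop] fun L => 1 / √L)
    {v : ℝ → ℝ} (hv : ∀ᶠ L in atTop, 0 < v L ∧ normalizedCall L (v L) = c L) :
    (fun L => v L -
      (√2 * (√(p + 1) - √p) * √L + b / √2 * (1 / √p - 1 / √(p + 1))
        + (2 * d + 1) / (2 * √2) * (1 / √p - 1 / √(p + 1)) * (Real.log L / √L)
        + (1 / √2 * (1 / √(p + 1) - 1 / √p) * volConst p c₀
            + b ^ 2 / (4 * √2) * (1 / (p * √p) - 1 / ((p + 1) * √(p + 1)))) * (1 / √L)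
        + b * (2 * d + 1) / (4 * √2) * (1 / (p * √p) - 1 / ((p + 1) * √(p + 1)))
            * (Real.log L / L))) =O[atTop] fun L => 1 / L := by
  have hex : ∃ s : ℝ → ℝ, ∀ᶠ L in atTop, |s L| ≤ 1 ∧
      v L = totalVol L (halfSqApprox p b d c₀ L + s L) := by
    have : ∀ᶠ L in atTop, ∃ t : ℝ, |t| ≤ 1 ∧
        v L = totalVol L (halfSqApprox p b d c₀ L + t) := by
      filter_upwards [eventually_exists_totalVol hp hc₀ hcpos hc, hv] with L h1 h2
      obtain ⟨w, hw, h3, h4⟩ := h1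
      refine ⟨w - halfSqApprox p b d c₀ L, hw, ?_⟩
      rw [add_sub_cancel]
      exact (strictMonoOn_normalizedCall L).injOn h2.1 h3 (h2.2.trans h4.symm)
    exact this.choice
  obtain ⟨s, hs⟩ := hex
  have hs1 : s =O[atTop] fun _ => (1 : ℝ) := by
    refine IsBigO.of_bound 1 (hs.mono fun L h => ?_)
    simpa using h.1
  have hsO : s =O[atTop] fun L => 1 / √L := by
    refine (log_normalizedCall_sub_log hp hc₀ hc hs1).2.congr' ?_ .rfl
    filter_upwards [hs, hv] with L h1 h2
    rw [← h1.2, h2.2]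
    ring
  have e1 := sqrt_expansion (b := b) (m := d + 1 / 2) (k := volConst p c₀)
    (by linarith : 0 < p + 1) hsO
  have e2 := sqrt_expansion (b := b) (m := d + 1 / 2) (k := volConst p c₀) hp hsO
  refine (e1.sub e2).congr' ?_ .rfl
  filter_upwards [hs, eventually_gt_atTop 0] with L h hL
  rw [h.2, totalVol, halfSqApprox]
  have hq : (p + 1) * L - (b * √L + (d + 1 / 2) * Real.log L - volConst p c₀) + s L =
      p * L - (b * √L + (d + 1 / 2) * Real.log L - volConst p c₀) + s L + L := by ring
  rw [hq]
  generalize √(2 * (p * L - (b * √L + (d + 1 / 2) * Real.log L - volConst p c₀) + s L + L)) = R₁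
  generalize √(2 * (p * L - (b * √L + (d + 1 / 2) * Real.log L - volConst p c₀) + s L)) = R₂
  have hinv : 1 / √2 = √2 / 2 := by
    rw [div_eq_div_iff (by positivity) two_ne_zero, Real.mul_self_sqrt zero_le_two, one_mul]
  have k1 : b / √2 = b * (√2 / 2) := by rw [← hinv]; ring
  have k2 : (2 * d + 1) / (2 * √2) = (2 * d + 1) / 2 * (√2 / 2) := by rw [← hinv]; field_simp
  have k3 : b ^ 2 / (4 * √2) = b ^ 2 / 4 * (√2 / 2) := by rw [← hinv]; field_simp
  have k4 : b * (2 * d + 1) / (4 * √2) = b * (2 * d + 1) / 4 * (√2 / 2) := by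
    rw [← hinv]; field_simp
  rw [k1, k2, k3, k4, hinv]
  have : √2 / (2 * √p) = √2 / 2 * (1 / √p) := by field_simp
  have : √2 / (2 * √(p + 1)) = √2 / 2 * (1 / √(p + 1)) := by field_simp
  have : √2 / (8 * (p * √p)) = √2 / 8 * (1 / (p * √p)) := by field_simp
  have : √2 / (8 * ((p + 1) * √(p + 1))) = √2 / 8 * (1 / ((p + 1) * √(p + 1))) := by field_simp
  simp only [*]
  ring

end TotalVolatility

/-! ### The implied volatility -/

theorem theorem6p1 {Ω : Type*} [mΩ : MeasurableSpace Ω] (P : Measure Ω) [IsProbabilityMeasure P]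
    (ℱ : Filtration ℝ≥0 mΩ) (X : ℝ≥0 → Ω → ℝ) (hX : Martingale X ℱ P)
    (x₀ : ℝ) (hx₀ : 0 < x₀) (hX₀ : ∀ᵐ ω ∂P, X 0 ω = x₀)
    (T : ℝ≥0) (hT : 0 < T)
    (D : ℝ → ℝ) (hD : IsPositiveDensity P (X T) D)
    (r₁ r₂ r₃ r₄ : ℝ) (hr₁ : 0 < r₁) (hr₂ : 0 ≤ r₂) (hr₃ : 2 < r₃)
    (htail : HasDensityTail D r₁ r₂ r₃ r₄) :
    (∀ᶠ K in atTop, ∃! σ : ℝ, IsImpliedVolatility x₀ T K (callPrice P (X T) K) σ) ∧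
    ∀ I : ℝ → ℝ,
      (∀ᶠ K in atTop, IsImpliedVolatility x₀ T K (callPrice P (X T) K) (I K)) →
      (fun K : ℝ => I K -
        (√2 / √(T : ℝ) * (√(r₃ - 1) - √(r₃ - 2)) * √(Real.log (K / x₀))
          + r₂ / √(2 * (T : ℝ)) * (1 / √(r₃ - 2) - 1 / √(r₃ - 1))
          + (2 * r₄ + 1) / (2 * √(2 * (T : ℝ))) * (1 / √(r₃ - 2) - 1 / √(r₃ - 1))
              * (Real.log (Real.log (K / x₀)) / √(Real.log (K / x₀)))
          + (1 / √(2 * (T : ℝ)) * (1 / √(r₃ - 1) - 1 / √(r₃ - 2))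
                * Real.log (√(r₃ - 1) * √(r₃ - 2) * (√(r₃ - 1) - √(r₃ - 2))
                    / (2 * √Real.pi * (r₁ * x₀ ^ (1 - r₃))))
              + r₂ ^ 2 / (4 * √(2 * (T : ℝ)))
                * (1 / (r₃ - 2) ^ (3 / 2 : ℝ) - 1 / (r₃ - 1) ^ (3 / 2 : ℝ)))
              * (1 / √(Real.log (K / x₀)))
          + r₂ * (2 * r₄ + 1) / (4 * √(2 * (T : ℝ)))
              * (1 / (r₃ - 2) ^ (3 / 2 : ℝ) - 1 / (r₃ - 1) ^ (3 / 2 : ℝ))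
              * (Real.log (Real.log (K / x₀)) / Real.log (K / x₀))))
        =O[atTop] fun K : ℝ => 1 / Real.log (K / x₀) := by
  have hp : 0 < r₃ - 2 := by linarith
  have hc₀ : 0 < r₁ * x₀ ^ (1 - r₃) := by positivity
  have hq : r₃ - 2 + 1 = r₃ - 1 := by ring
  have hsT : 0 < √(T : ℝ) := Real.sqrt_pos.2 hT
  obtain ⟨hcpos, hc⟩ := log_callPrice_asymptotics (hX.integrable T).aemeasurable hD hx₀ hr₁ hr₂
    hr₃ htail
  rw [← hq] at hc
  have hLtop : Tendsto (fun K => Real.log (K / x₀)) atTop atTop :=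
    Real.tendsto_log_atTop.comp (tendsto_id.atTop_div_const hx₀)
  have hKtop : Tendsto (fun L => x₀ * Real.exp L) atTop atTop :=
    Real.tendsto_exp_atTop.const_mul_atTop hx₀
  have hK : ∀ K, 0 < K → x₀ * Real.exp (Real.log (K / x₀)) = K := fun K hK => by
    rw [Real.exp_log (div_pos hK hx₀)]
    field_simp
  have hiff : ∀ L σ, IsImpliedVolatility x₀ T (x₀ * Real.exp L)
      (callPrice P (X T) (x₀ * Real.exp L)) σ ↔
      0 < σ * √(T : ℝ) ∧
        normalizedCall L (σ * √(T : ℝ)) = callPrice P (X T) (x₀ * Real.exp L) / x₀ := by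
    intro L σ
    rw [IsImpliedVolatility, blackScholesCall_eq hx₀, eq_div_iff hx₀.ne', mul_comm x₀,
      mul_pos_iff_of_pos_right hsT]
  constructor
  · filter_upwards [hLtop.eventually (eventually_existsUnique_totalVol hp hc₀ hcpos hc),
      eventually_gt_atTop 0] with K h hK0
    obtain ⟨v, hv, huniq⟩ := h
    rw [← hK K hK0]
    have hvT : v / √(T : ℝ) * √(T : ℝ) = v := div_mul_cancel₀ v hsT.ne'
    refine ⟨v / √(T : ℝ), (hiff _ _).2 (by rwa [hvT]), fun σ hσ => ?_⟩
    exact eq_div_of_mul_eq hsT.ne' (huniq _ ((hiff _ _).1 hσ))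
  · intro I hI
    have hv : ∀ᶠ L in atTop, 0 < I (x₀ * Real.exp L) * √(T : ℝ) ∧
        normalizedCall L (I (x₀ * Real.exp L) * √(T : ℝ)) =
          callPrice P (X T) (x₀ * Real.exp L) / x₀ :=
      (hKtop.eventually hI).mono fun L h => (hiff L _).1 h
    have hmain := ((totalVol_expansion hp hc₀ hcpos hc hv).const_mul_left
      (1 / √(T : ℝ))).comp_tendsto hLtop
    refine hmain.congr' ?_ .rfl
    filter_upwards [eventually_gt_atTop 0] with K hK0
    have hpow : ∀ a : ℝ, 0 < a → a ^ (3 / 2 : ℝ) = a * √a := fun a ha => by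
      rw [show (3 / 2 : ℝ) = 1 + 1 / 2 by norm_num, Real.rpow_add ha, Real.rpow_one,
        Real.sqrt_eq_rpow]
    simp only [Function.comp_apply]
    rw [hK K hK0, volConst, hq, hpow _ hp, hpow _ (by linarith : 0 < r₃ - 1),
      Real.sqrt_mul zero_le_two]
    have h2 : √(2 : ℝ) ≠ 0 := by positivity
    have hT' := hsT.ne'
    generalize Real.log (√(r₃ - 1) * √(r₃ - 2) * (√(r₃ - 1) - √(r₃ - 2))
      / (2 * √Real.pi * (r₁ * x₀ ^ (1 - r₃)))) = Λ
    generalize 1 / √(r₃ - 2) = A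
    generalize 1 / √(r₃ - 1) = B
    generalize 1 / ((r₃ - 2) * √(r₃ - 2)) = A'
    generalize 1 / ((r₃ - 1) * √(r₃ - 1)) = B'
    generalize Real.log (K / x₀) = L
    generalize Real.log L / √L = u₁
    generalize Real.log L / L = u₂
    generalize 1 / √L = u₃
    field_simp
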